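/- Let $p \ge 3$ and $1 \le k \le \frac{p}{2}$ be integers, and let $R \in \mathrm{SL}(3,\mathbb{R})$ be a rotation by the angle $\frac{2\pi}{p}$, that is, the eigenvalues of $R$ are $1$ and $e^{\pm 2\pi i/p}$. Let $\mathrm{SL}(3,\mathbb{R})$ act on the real projective plane $\mathbb{R}\mathrm{P}^2$ (the space of lines through the origin in $\mathbb{R}^3$) in the usual way, and let $\gamma \colon S^1 = \mathbb{R}/\mathbb{Z} \to \mathbb{R}\mathrm{P}^2$ be an injective continuous curve satisfying $\gamma\left(t + \frac{1}{p}\right) = R^k \gamma(t)$ for all $t \in \mathbb{R}/\mathbb{Z}$. Then 1. either $k = 1$ and $\gamma$ is null-homotopic, 2. or $p$ is odd, $k = \frac{p-1}{2}$ and $\gamma$ is not null-homotopic. -/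

import Mathlib

open scoped LinearAlgebra.Projectivization

/-- The real projective plane `ℝP²`, the set of lines through the origin of `ℝ³`. It carries the
action of `SL(3,ℝ)` on lines that Mathlib defines on every projectivization. -/
abbrev RealProjectivePlane : Type := ℙ ℝ (Fin 3 → ℝ)

/-- The usual topology of `ℝP²`: the quotient topology for `ℝ³ ∖ {0} → ℝP²`, `v ↦ ℝ v`. -/
noncomputable instance instTopologicalSpaceRealProjectivePlane : TopologicalSpace RealProjectivePlane :=
  TopologicalSpace.coinduced
    (fun v : {v : Fin 3 → ℝ // v ≠ 0} => Projectivization.mk' ℝ v) inferInstance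

/-! Injectivity keeps `γ` off the fixed point of `R` given by its axis, so `γ` lies in an open
Möbius band. In the universal cover, an angle `b` and a height `h` taken modulo `(b, h) ↦ (b + nπ,
(-1)^n h)`, one symmetry step adds `(2k/p + j)π` to `b` and multiplies `h` by `(-1)^j`, for a fixed
integer `j`. One period thus makes `m = jp + 2k` half turns.

For `m ≠ 0` the lifted curve must meet its translate by `2π` (`exists_chord`, from
Poincaré–Miranda). Injectivity says the two parameters differ by an integer `i`, so `i * m = 2`.
With `1 ≤ k ≤ p/2` this leaves `k = 1`, `p = 2k + 1` or `p = 2k + 2`; the last, like `m = 0`,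
produces a self-intersection (`winding_of_equivariant_simple_curve`).

The lift of `γ` to the sphere is multiplied by `(-1)^m` over one period, and this sign decides
whether `γ` is null-homotopic. -/

open Metric Set Topology

/-! ### The double cover of the projective plane; lifts and logarithms -/

/-- The double covering of the projective plane by the unit sphere of the sup norm. -/
noncomputable def sphereToProjectivePlane (v : sphere (0 : Fin 3 → ℝ) 1) : RealProjectivePlane :=
  Projectivization.mk ℝ v.1 (ne_zero_of_mem_unit_sphere v)

theorem continuous_projectivization_mk' :
    Continuous (fun v : {v : Fin 3 → ℝ // v ≠ 0} => (Projectivization.mk' ℝ v : RealProjectivePlane)) :=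
  continuous_coinduced_rng

theorem isQuotientMap_projectivization_mk' :
    IsQuotientMap (fun v : {v : Fin 3 → ℝ // v ≠ 0} =>
      (Projectivization.mk' ℝ v : RealProjectivePlane)) :=
  ⟨⟨rfl⟩, fun x => by
    induction x using Projectivization.ind with
    | h v hv => exact ⟨⟨v, hv⟩, rfl⟩⟩

theorem continuous_sphereToProjectivePlane : Continuous sphereToProjectivePlane :=
  continuous_projectivization_mk'.comp
    (f := fun v : sphere (0 : Fin 3 → ℝ) 1 =>
      (⟨v.1, ne_zero_of_mem_unit_sphere v⟩ : {v : Fin 3 → ℝ // v ≠ 0}))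
    (continuous_subtype_val.subtype_mk _)

theorem isQuotientMap_sphereToProjectivePlane : IsQuotientMap sphereToProjectivePlane := by
  let f : {v : Fin 3 → ℝ // v ≠ 0} → sphere (0 : Fin 3 → ℝ) 1 := fun v =>
    ⟨‖v.1‖⁻¹ • v.1, by
      have : ‖v.1‖ ≠ 0 := norm_ne_zero_iff.2 v.2
      simp [norm_smul, this]⟩
  have hf : Continuous f := by
    refine Continuous.subtype_mk ?_ _
    exact (continuous_subtype_val.norm.inv₀ fun v => norm_ne_zero_iff.2 v.2).smul
      continuous_subtype_val
  refine IsQuotientMap.of_comp hf continuous_sphereToProjectivePlane ?_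
  convert isQuotientMap_projectivization_mk' using 2 with v
  refine (Projectivization.mk_eq_mk_iff' ℝ _ _ _ v.2).2 ⟨‖v.1‖⁻¹, rfl⟩

/-- The fibres are the orbits of `{1, -1}`, which appears here as the unit sphere of `ℝ`, acting on
the sphere by scaling. -/
theorem isCoveringMap_sphereToProjectivePlane : IsCoveringMap sphereToProjectivePlane := by
  have : IsQuotientCoveringMap sphereToProjectivePlane (sphere (0 : ℝ) 1) :=
    { isQuotientMap_sphereToProjectivePlane with
      continuous_const_smul := fun c => continuous_const_smul c
      apply_eq_iff_mem_orbit := by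
        intro x y
        rw [sphereToProjectivePlane, sphereToProjectivePlane, Projectivization.mk_eq_mk_iff']
        constructor
        · rintro ⟨a, ha⟩
          have h := congrArg norm ha
          rw [norm_smul, norm_eq_of_mem_sphere, norm_eq_of_mem_sphere, mul_one] at h
          exact ⟨⟨a, by simpa using h⟩, Subtype.ext ha⟩
        · rintro ⟨a, ha⟩
          exact ⟨a.1, congrArg Subtype.val ha⟩
      disjoint := by
        intro e
        -- Antipodal points are at distance 2, so a ball of radius 1 cannot contain both.
        refine ⟨ball e 1, ball_mem_nhds _ one_pos, ?_⟩
        rintro g ⟨_, ⟨x, hx, rfl⟩, hy⟩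
        have hg : |g.1| = 1 := norm_eq_of_mem_sphere g
        rcases eq_or_eq_neg_of_abs_eq hg with h | h
        · exact Subtype.ext h
        · exfalso
          have h1 : dist (g • x) x < 2 := by
            have := dist_triangle_right (g • x) x e
            have h2 := mem_ball.1 hx
            have h3 := mem_ball.1 hy
            simp only at h3
            linarith
          have h4 : ((g • x : sphere (0 : Fin 3 → ℝ) 1) : Fin 3 → ℝ) = -x.1 := by
            change g.1 • x.1 = _
            rw [h, neg_one_smul]
          rw [Subtype.dist_eq, h4, dist_eq_norm, ← neg_add', norm_neg, ← two_smul ℝ, norm_smul,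
            norm_eq_of_mem_sphere] at h1
          norm_num at h1 }
  exact this.isCoveringMap

theorem exists_continuous_lift_sphere {A : Type*} [TopologicalSpace A] [SimplyConnectedSpace A]
    [LocallyPathConnectedSpace A] (f : C(A, RealProjectivePlane)) :
    ∃ v : C(A, sphere (0 : Fin 3 → ℝ) 1), ∀ a, sphereToProjectivePlane (v a) = f a := by
  obtain ⟨a⟩ : Nonempty A := inferInstance
  obtain ⟨e, he⟩ := isQuotientMap_sphereToProjectivePlane.surjective (f a)
  obtain ⟨F, hF, -⟩ := isCoveringMap_sphereToProjectivePlane.existsUnique_continuousMap_lifts f a e he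
  exact ⟨F, congrFun hF.2⟩

theorem exists_continuous_log {A : Type*} [TopologicalSpace A] [SimplyConnectedSpace A]
    [LocallyPathConnectedSpace A] (f : C(A, ℂ)) (hf : ∀ a, f a ≠ 0) :
    ∃ g : C(A, ℂ), ∀ a, Complex.exp (g a) = f a := by
  obtain ⟨a⟩ : Nonempty A := inferInstance
  obtain ⟨F, hF, -⟩ := Complex.isCoveringMapOn_exp.existsUnique_continuousMap_lifts f
    (a₀ := a) (e₀ := Complex.log (f a)) (Complex.exp_log (hf a)) hf
  exact ⟨F, congrFun hF.2⟩

/-! ### Planar topology: Poincaré–Miranda and chords of periodic curves -/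

theorem IsPreconnected.mem_Ioo_of_notMem_image {X : Type*} [TopologicalSpace X] {S : Set X}
    (hS : IsPreconnected S) {φ : X → ℝ} (hφ : ContinuousOn φ S) {l r : ℝ}
    (hl : ∀ z ∈ S, φ z ≠ l) (hr : ∀ z ∈ S, φ z ≠ r) {x y : X} (hx : x ∈ S) (hy : y ∈ S)
    (h : φ x ∈ Ioo l r) : φ y ∈ Ioo l r := by
  constructor
  · by_contra! hn
    obtain ⟨z, hz, hz'⟩ := hS.intermediate_value hy hx hφ ⟨hn, h.1.le⟩
    exact hl z hz hz'
  · by_contra! hn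
    obtain ⟨z, hz, hz'⟩ := hS.intermediate_value hx hy hφ ⟨h.2.le, hn⟩
    exact hr z hz hz'

theorem Real.gt_or_lt_of_cos_neg {x : ℝ} (h : Real.cos x < 0) : Real.pi / 2 < x ∨ x < -(Real.pi / 2) := by
  by_contra! hn
  exact absurd (Real.cos_nonneg_of_neg_pi_div_two_le_of_le hn.2 hn.1) (not_le.2 h)

/-- No continuous angle function on the plane turns once around the boundary of a rectangle. -/
theorem not_angle_turns_once (φ : ℝ × ℝ → ℝ) (hφ : Continuous φ) {a b c d : ℝ}
    (hac : ∀ t ∈ uIcc c d, Real.cos (φ (a, t)) < 0)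
    (hbc : ∀ t ∈ uIcc c d, 0 < Real.cos (φ (b, t)))
    (hcs : ∀ s ∈ uIcc a b, Real.sin (φ (s, c)) ≤ 0)
    (hds : ∀ s ∈ uIcc a b, 0 ≤ Real.sin (φ (s, d)))
    (h0 : φ (b, c) ∈ Ioo (-(Real.pi / 2)) (Real.pi / 2)) : False := by
  have hpi := Real.pi_pos
  have c1 : Real.cos (Real.pi / 2) = 0 := Real.cos_pi_div_two
  have c2 : Real.cos (-(Real.pi / 2)) = 0 := by simp
  have c3 : Real.cos (3 * Real.pi / 2) = 0 := by
    rw [show 3 * Real.pi / 2 = Real.pi / 2 + Real.pi by ring, Real.cos_add_pi]; simp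
  have s1 : Real.sin (-(Real.pi / 2)) = -1 := by simp
  have s3 : Real.sin (3 * Real.pi / 2) = -1 := by
    rw [show 3 * Real.pi / 2 = Real.pi / 2 + Real.pi by ring, Real.sin_add_pi]; simp
  have s4 : Real.sin (-(3 * Real.pi / 2)) = 1 := by rw [Real.sin_neg, s3]; norm_num
  have cont (s : ℝ) : ContinuousOn (fun t => φ (s, t)) (uIcc c d) := by fun_prop
  have cont' (t : ℝ) : ContinuousOn (fun s => φ (s, t)) (uIcc a b) := by fun_prop
  -- Follow the angle from the corner `(b, c)` to `(a, d)` through `(b, d)`, and separately to `(a,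
  -- c)`. It ends above `π/2` at `(a, d)` and below `π/2` at `(a, c)`, yet it cannot cross `π/2` on
  -- the side between them.
  have hbd := isPreconnected_uIcc.mem_Ioo_of_notMem_image (cont b)
    (l := -(Real.pi / 2)) (r := Real.pi / 2)
    (fun z hz h => by have := hbc z hz; rw [h, c2] at this; exact lt_irrefl _ this)
    (fun z hz h => by have := hbc z hz; rw [h, c1] at this; exact lt_irrefl _ this)
    left_mem_uIcc right_mem_uIcc h0
  have had := isPreconnected_uIcc.mem_Ioo_of_notMem_image (cont' d)
    (l := -(Real.pi / 2)) (r := 3 * Real.pi / 2)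
    (fun z hz h => by have := hds z hz; rw [h, s1] at this; linarith)
    (fun z hz h => by have := hds z hz; rw [h, s3] at this; linarith)
    right_mem_uIcc left_mem_uIcc ⟨hbd.1, by linarith [hbd.2]⟩
  have hac' := isPreconnected_uIcc.mem_Ioo_of_notMem_image (cont' c)
    (l := -(3 * Real.pi / 2)) (r := Real.pi / 2)
    (fun z hz h => by have := hcs z hz; rw [h, s4] at this; linarith)
    (fun z hz h => by have := hcs z hz; rw [h, Real.sin_pi_div_two] at this; linarith)
    right_mem_uIcc left_mem_uIcc ⟨by linarith [h0.1], h0.2⟩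
  have had' : Real.pi / 2 < φ (a, d) := by
    rcases Real.gt_or_lt_of_cos_neg
      (hac d right_mem_uIcc) with h | h
    · exact h
    · linarith [had.1]
  have := isPreconnected_uIcc.mem_Ioo_of_notMem_image (cont a)
    (l := Real.pi / 2) (r := 3 * Real.pi / 2)
    (fun z hz h => by have := hac z hz; rw [h, c1] at this; exact lt_irrefl _ this)
    (fun z hz h => by have := hac z hz; rw [h, c3] at this; exact lt_irrefl _ this)
    right_mem_uIcc left_mem_uIcc ⟨had', had.2⟩
  linarith [this.1, hac'.2]

/-- The Poincaré–Miranda theorem in the plane. -/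
theorem exists_eq_zero_of_rectangle (f g : ℝ × ℝ → ℝ) (hf : Continuous f) (hg : Continuous g)
    {a b c d : ℝ} (hfa : ∀ t ∈ uIcc c d, f (a, t) < 0) (hfb : ∀ t ∈ uIcc c d, 0 < f (b, t))
    (hgc : ∀ s ∈ uIcc a b, g (s, c) ≤ 0) (hgd : ∀ s ∈ uIcc a b, 0 ≤ g (s, d)) :
    ∃ x, f x = 0 ∧ g x = 0 := by
  by_contra! hne
  obtain ⟨G, hG⟩ := exists_continuous_log (A := ℝ × ℝ) ⟨fun x => ⟨f x, g x⟩, by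
    rw [← Complex.equivRealProdCLM.toHomeomorph.comp_continuous_iff]
    exact hf.prodMk hg⟩ (fun x hx =>
      hne x (congrArg Complex.re hx) (congrArg Complex.im hx))
  have hre (x) : Real.exp (G x).re * Real.cos (G x).im = f x := by
    rw [← Complex.exp_re, hG]; rfl
  have him (x) : Real.exp (G x).re * Real.sin (G x).im = g x := by
    rw [← Complex.exp_im, hG]; rfl
  have hcos : 0 < Real.cos (G (b, c)).im := by
    have := hfb c left_mem_uIcc
    rw [← hre] at this
    exact pos_of_mul_pos_right this (Real.exp_pos _).le
  -- Shift the angle by a multiple of `2π` so that its value at `(b, c)` is the principal one.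
  let θ : Real.Angle := ((G (b, c)).im : Real.Angle)
  obtain ⟨n, hn⟩ := Real.Angle.angle_eq_iff_two_pi_dvd_sub.1
    (Real.Angle.coe_toReal θ : (θ.toReal : Real.Angle) = ((G (b, c)).im : Real.Angle))
  have hper (x) : (G x).im + θ.toReal - (G (b, c)).im = (G x).im + n * (2 * Real.pi) := by
    linarith
  have hc (x) : Real.cos ((G x).im + θ.toReal - (G (b, c)).im) = Real.cos (G x).im := by
    rw [hper, Real.cos_add_int_mul_two_pi]
  have hs (x) : Real.sin ((G x).im + θ.toReal - (G (b, c)).im) = Real.sin (G x).im := by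
    rw [hper, Real.sin_add_int_mul_two_pi]
  refine not_angle_turns_once (fun x => (G x).im + θ.toReal - (G (b, c)).im) (by fun_prop)
    (a := a) (b := b) (c := c) (d := d) ?_ ?_ ?_ ?_ ?_
  · intro t ht
    have := hfa t ht
    rw [← hre] at this
    rw [hc]
    by_contra! h
    exact absurd (mul_nonneg (Real.exp_pos _).le h) (not_le.2 this)
  · intro t ht
    have := hfb t ht
    rw [← hre] at this
    rw [hc]
    exact pos_of_mul_pos_right this (Real.exp_pos _).le
  · intro s hs'
    have := hgc s hs'
    rw [← him] at this
    rw [hs]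
    by_contra! h
    exact absurd (mul_pos (Real.exp_pos _) h) (not_lt.2 this)
  · intro s hs'
    have := hgd s hs'
    rw [← him] at this
    rw [hs]
    exact nonneg_of_mul_nonneg_right this (Real.exp_pos _)
  · have := Real.Angle.cos_pos_iff_abs_toReal_lt_pi_div_two (θ := θ).1 hcos
    rw [abs_lt] at this
    simpa using this

theorem Function.Periodic.exists_forall_le_le {h : ℝ → ℝ} {T : ℝ} (hper : Function.Periodic h T)
    (hT : 0 < T) (hc : Continuous h) : ∃ x y, ∀ s, h x ≤ h s ∧ h s ≤ h y := by
  have hne : (Icc (0 : ℝ) (0 + T)).Nonempty := nonempty_Icc.2 (by linarith)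
  obtain ⟨x, -, hx⟩ := isCompact_Icc.exists_isMinOn hne hc.continuousOn
  obtain ⟨y, -, hy⟩ := isCompact_Icc.exists_isMaxOn hne hc.continuousOn
  refine ⟨x, y, fun s => ?_⟩
  obtain ⟨u, hu, hsu⟩ := hper.exists_mem_Ico hT s 0
  rw [hsu]
  exact ⟨hx (Ico_subset_Icc_self hu), hy (Ico_subset_Icc_self hu)⟩

/-- A periodic curve in the plane meets each of its translates along the direction of its period. -/
theorem exists_chord {b h : ℝ → ℝ} (hb : Continuous b) (hh : Continuous h) {T c : ℝ} (hT : 0 < T)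
    (hc : c ≠ 0) (hper : Function.Periodic h T) (hbT : ∀ t, b (t + T) = b t + c) (a : ℝ) :
    ∃ s t, b s = b t + a ∧ h s = h t := by
  obtain ⟨x, y, hxy⟩ := hper.exists_forall_le_le hT hh
  have hbn (n : ℕ) : ∀ t, b (t + n * T) = b t + n * c := by
    induction n with
    | zero => simp
    | succ n ih =>
      intro t
      rw [show t + ((n + 1 : ℕ) : ℝ) * T = (t + n * T) + T by push_cast; ring, hbT, ih]
      push_cast; ring
  have hbn' (n : ℕ) : b (-(n * T)) = b 0 - n * c := by
    have := hbn n (-(n * T))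
    rw [neg_add_cancel] at this
    linarith
  obtain ⟨M, hM⟩ := (isCompact_uIcc (a := y) (b := x)).exists_bound_of_continuousOn
    (f := fun t => b 0 - b t - a) (by fun_prop)
  obtain ⟨n, hn⟩ := exists_nat_gt (M / |c|)
  rw [div_lt_iff₀ (abs_pos.2 hc)] at hn
  -- Shifting the parameter by many periods moves `b` arbitrarily far either way; the sign of `c`
  -- decides which end is which.
  have key : ∃ α β, (∀ t ∈ uIcc y x, b α - b t - a < 0) ∧ ∀ t ∈ uIcc y x, 0 < b β - b t - a := by
    have h1 := hbn n 0
    have h2 := hbn' n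
    rw [zero_add] at h1
    rcases lt_or_gt_of_ne hc with hneg | hpos
    · rw [abs_of_neg hneg] at hn
      refine ⟨n * T, -(n * T), fun t ht => ?_, fun t ht => ?_⟩ <;>
      · have := abs_le.1 (hM t ht)
        linarith
    · rw [abs_of_pos hpos] at hn
      refine ⟨-(n * T), n * T, fun t ht => ?_, fun t ht => ?_⟩ <;>
      · have := abs_le.1 (hM t ht)
        linarith
  obtain ⟨α, β, hα, hβ⟩ := key
  -- The second parameter runs between a maximum and a minimum of `h`, which fixes the sign of `h s
  -- - h t` on those two sides.
  obtain ⟨z, h1, h2⟩ := exists_eq_zero_of_rectangle (fun z => b z.1 - b z.2 - a)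
    (fun z => h z.1 - h z.2) (by fun_prop) (by fun_prop) hα hβ
    (fun s _ => sub_nonpos.2 (hxy s).2) (fun s _ => sub_nonneg.2 (hxy s).1)
  exact ⟨z.1, z.2, by linarith, by linarith⟩

/-! ### Null-homotopy read off from the lift to the sphere -/

theorem sphereToProjectivePlane_eq_iff {x y : sphere (0 : Fin 3 → ℝ) 1} :
    sphereToProjectivePlane x = sphereToProjectivePlane y ↔ x = y ∨ x = -y := by
  rw [sphereToProjectivePlane, sphereToProjectivePlane, Projectivization.mk_eq_mk_iff']
  constructor
  · rintro ⟨a, ha⟩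
    have h := congrArg norm ha
    rw [norm_smul, norm_eq_of_mem_sphere, norm_eq_of_mem_sphere, mul_one, Real.norm_eq_abs] at h
    rcases eq_or_eq_neg_of_abs_eq h with rfl | rfl
    · exact .inl (Subtype.ext (by simpa using ha.symm))
    · exact .inr (Subtype.ext (by simpa using ha.symm))
  · rintro (rfl | rfl)
    · exact ⟨1, one_smul _ _⟩
    · exact ⟨-1, by simp⟩

theorem eq_or_eq_neg_of_sphereToProjectivePlane {A : Type*} [TopologicalSpace A]
    [PreconnectedSpace A] [Nonempty A] {u w : A → sphere (0 : Fin 3 → ℝ) 1} (hu : Continuous u)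
    (hw : Continuous w)
    (h : ∀ a, sphereToProjectivePlane (u a) = sphereToProjectivePlane (w a)) :
    (∀ a, u a = w a) ∨ ∀ a, u a = -w a := by
  obtain ⟨a⟩ : Nonempty A := inferInstance
  rcases sphereToProjectivePlane_eq_iff.1 (h a) with ha | ha
  · exact .inl (congrFun
      (isCoveringMap_sphereToProjectivePlane.eq_of_comp_eq hu hw (funext h) a ha))
  · refine .inr (congrFun
      (isCoveringMap_sphereToProjectivePlane.eq_of_comp_eq hu hw.neg (funext fun b => ?_) a ha))
    exact (h b).trans (sphereToProjectivePlane_eq_iff.2 (.inr (neg_neg _).symm))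

/-- A lifted null-homotopy changes by one constant sign under `t ↦ t + 1`. That sign is `+` at the
constant end and `-` at the end of `γ`. -/
theorem not_nullhomotopic_of_antiperiodic_lift (γ : C(UnitAddCircle, RealProjectivePlane))
    (v : C(ℝ, sphere (0 : Fin 3 → ℝ) 1))
    (hv : ∀ t : ℝ, sphereToProjectivePlane (v t) = γ t) (hanti : ∀ t, v (t + 1) = -v t) :
    ¬ γ.Nullhomotopic := by
  rintro ⟨y, ⟨H⟩⟩
  let q : ℝ → UnitAddCircle := fun t => (t : UnitAddCircle)
  have hq : Continuous q := AddCircle.continuous_mk' 1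
  have hq1 (t : ℝ) : q (t + 1) = q t := AddCircle.coe_add_period 1 t
  -- Clamping the time variable extends the homotopy to the simply connected plane.
  let f : C(ℝ × ℝ, RealProjectivePlane) :=
    ⟨fun x => H (projIcc 0 1 zero_le_one x.1, q x.2), H.continuous.comp
      ((continuous_projIcc.comp continuous_fst).prodMk (hq.comp continuous_snd))⟩
  obtain ⟨V, hV⟩ := exists_continuous_lift_sphere f
  have hf0 (t : ℝ) : f (0, t) = γ t := by
    change H (projIcc 0 1 zero_le_one 0, q t) = _
    rw [projIcc_left]
    exact H.apply_zero _
  have hf1 (t : ℝ) : f (1, t) = y := by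
    change H (projIcc 0 1 zero_le_one 1, q t) = _
    rw [projIcc_right]
    exact H.apply_one _
  have hper (x : ℝ × ℝ) : f (x.1, x.2 + 1) = f x := by
    change H (_, q (x.2 + 1)) = H (_, q x.2)
    rw [hq1]
  have hself (x : sphere (0 : Fin 3 → ℝ) 1) : x ≠ -x := fun h =>
    ne_zero_of_mem_unit_sphere x (self_eq_neg.1 (congrArg Subtype.val h))
  have hconst := eq_or_eq_neg_of_sphereToProjectivePlane (u := fun t : ℝ => V (1, t))
    (w := fun _ : ℝ => V (1, 0)) (by fun_prop) (by fun_prop) fun t => by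
      rw [hV, hV, hf1, hf1]
  replace hconst : ∀ t : ℝ, V (1, t) = V (1, 0) :=
    hconst.resolve_right fun h => hself _ (h 0)
  have hVper := eq_or_eq_neg_of_sphereToProjectivePlane (u := fun x : ℝ × ℝ => V (x.1, x.2 + 1))
    (w := V) (by fun_prop) (by fun_prop) fun x => by rw [hV, hV, hper]
  replace hVper : ∀ x : ℝ × ℝ, V (x.1, x.2 + 1) = V x :=
    hVper.resolve_right fun h => by
      have := h (1, 0)
      rw [hconst] at this
      exact hself _ this
  have h1 := hVper (0, 0)
  have h2 := hanti 0
  rcases eq_or_eq_neg_of_sphereToProjectivePlane (u := fun t : ℝ => V (0, t))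
    (w := v) (by fun_prop) (by fun_prop) fun x => by rw [hV, hv, hf0] with h | h
  · rw [h, h, h2] at h1
    exact hself _ h1.symm
  · rw [h, h, h2] at h1
    exact hself _ (neg_injective h1).symm

/-- The closed lift never meets the line `ℝ N`, so the segments from it to `N` avoid the origin and
project to a contraction of `γ`. -/
theorem nullhomotopic_of_periodic_lift (γ : C(UnitAddCircle, RealProjectivePlane))
    (v : C(ℝ, sphere (0 : Fin 3 → ℝ) 1))
    (hv : ∀ t : ℝ, sphereToProjectivePlane (v t) = γ t) (hper : Function.Periodic v 1)
    (N : Fin 3 → ℝ) (hN : N ≠ 0) (hne : ∀ (t c : ℝ), (v t).1 ≠ c • N) :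
    γ.Nullhomotopic := by
  let w : UnitAddCircle → sphere (0 : Fin 3 → ℝ) 1 := hper.lift
  have hw (t : ℝ) : w t = v t := hper.lift_coe t
  have hwc : Continuous w :=
    (QuotientAddGroup.isQuotientMap_mk (N := AddSubgroup.zmultiples (1 : ℝ))).continuous_iff.2
      v.continuous
  have hγw (x : UnitAddCircle) : γ x = sphereToProjectivePlane (w x) := by
    induction x using QuotientAddGroup.induction_on with
    | H t => exact (hv t).symm
  have hseg (x : unitInterval × UnitAddCircle) :
      (1 - (x.1 : ℝ)) • (w x.2).1 + (x.1 : ℝ) • N ≠ 0 := by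
    obtain ⟨s, x⟩ := x
    induction x using QuotientAddGroup.induction_on with
    | H t =>
      intro h0
      change (1 - (s : ℝ)) • (w (t : UnitAddCircle)).1 + (s : ℝ) • N = 0 at h0
      rw [hw] at h0
      rcases eq_or_ne (s : ℝ) 1 with hs | hs
      · simp [hs, hN] at h0
      · refine hne t (-((1 - (s : ℝ))⁻¹ * s)) ?_
        rw [neg_smul, mul_smul, ← smul_neg, ← eq_neg_of_add_eq_zero_left h0, smul_smul,
          inv_mul_cancel₀ (sub_ne_zero.2 hs.symm), one_smul]
  refine ⟨Projectivization.mk ℝ N hN, ⟨⟨⟨fun x => Projectivization.mk ℝ _ (hseg x), ?_⟩, ?_, ?_⟩⟩⟩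
  · refine continuous_projectivization_mk'.comp
      (f := fun x => (⟨_, hseg x⟩ : {v : Fin 3 → ℝ // v ≠ 0})) (Continuous.subtype_mk ?_ _)
    fun_prop
  · intro x
    rw [hγw]
    simp [sphereToProjectivePlane]
  · intro x
    simp

/-! ### Linear algebra of the rotation -/

theorem exists_vecMul_eq_smul_of_mem_roots {K : Type*} [Field K] {n : Type*} [Fintype n]
    [DecidableEq n] {M : Matrix n n K} {e : K} (h : e ∈ M.charpoly.roots) :
    ∃ w, w ≠ 0 ∧ Matrix.vecMul w M = e • w := by
  have h0 := (Polynomial.mem_roots'.1 h).2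
  rw [Polynomial.IsRoot, Matrix.eval_charpoly] at h0
  obtain ⟨w, hw, hw'⟩ := Matrix.exists_vecMul_eq_zero_iff.2 h0
  refine ⟨w, hw, ?_⟩
  rw [Matrix.vecMul_sub, sub_eq_zero, Matrix.scalar_apply, ← Matrix.smul_one_eq_diagonal,
    Matrix.vecMul_smul, Matrix.vecMul_one] at hw'
  exact hw'.symm

theorem eq_zero_of_dotProduct_eigenvectors {K : Type*} [Field K] {n : Type*} [Fintype n]
    [DecidableEq n] {M : Matrix n n K} {μ : n → K} (hμ : Function.Injective μ) {w : n → n → K}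
    (hw : ∀ i, w i ≠ 0) (hwM : ∀ i, Matrix.vecMul (w i) M = μ i • w i) {x : n → K}
    (hx : ∀ i, w i ⬝ᵥ x = 0) : x = 0 := by
  have h : LinearIndependent K (Matrix.of w).row :=
    Module.End.eigenvectors_linearIndependent' M.vecMulLinear μ hμ w fun i =>
      ⟨Module.End.mem_eigenspace_iff.2 (hwM i), hw i⟩
  refine Matrix.mulVec_injective_of_isUnit (Matrix.linearIndependent_rows_iff_isUnit.1 h) ?_
  rw [Matrix.mulVec_zero]
  exact funext hx

/-- Linear coordinates on `ℝ³` in which a rotation is standard. -/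
theorem exists_rotation_coordinates {M : Matrix (Fin 3) (Fin 3) ℝ} {e e' : ℂ}
    (hM : (M.map (algebraMap ℝ ℂ)).charpoly.roots = {1, e, e'}) (he : e' = starRingEnd ℂ e)
    (he1 : e ≠ 1) (hee : e ≠ e') :
    ∃ (l : (Fin 3 → ℝ) →ₗ[ℝ] ℝ) (z : (Fin 3 → ℝ) →ₗ[ℝ] ℂ), (∀ v, l (M.mulVec v) = l v) ∧
      (∀ v, z (M.mulVec v) = e * z v) ∧ ∀ v, l v = 0 → z v = 0 → v = 0 := by
  have h1 : (1 : ℝ) ∈ M.charpoly.roots := by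
    have : (1 : ℂ) ∈ (M.map (algebraMap ℝ ℂ)).charpoly.roots := by rw [hM]; simp
    have h := (Polynomial.mem_roots'.1 this).2
    rw [Matrix.charpoly_map, Polynomial.IsRoot, ← map_one (algebraMap ℝ ℂ), Polynomial.eval_map_apply,
      map_eq_zero] at h
    exact Polynomial.mem_roots'.2 ⟨(Matrix.charpoly_monic M).ne_zero, h⟩
  -- Pairing with a left eigenvector of `M` gives a functional that `M` scales by the eigenvalue.
  obtain ⟨u, hu0, hu⟩ := exists_vecMul_eq_smul_of_mem_roots h1
  obtain ⟨w, hw0, hw⟩ := exists_vecMul_eq_smul_of_mem_roots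
    (M := M.map (algebraMap ℝ ℂ)) (e := e) (by rw [hM]; simp)
  have hmul (v : Fin 3 → ℝ) : (fun i => ((M.mulVec v) i : ℂ)) =
      (M.map (algebraMap ℝ ℂ)).mulVec (fun i => (v i : ℂ)) := by
    ext i
    simp [Matrix.mulVec, dotProduct]
  let l : (Fin 3 → ℝ) →ₗ[ℝ] ℝ :=
    { toFun := fun v => u ⬝ᵥ v
      map_add' := dotProduct_add u
      map_smul' := fun c v => dotProduct_smul c u v }
  let z : (Fin 3 → ℝ) →ₗ[ℝ] ℂ :=
    { toFun := fun v => w ⬝ᵥ (fun i => (v i : ℂ))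
      map_add' := fun x y => by
        rw [← dotProduct_add]; congr 1; ext i; simp
      map_smul' := fun c v => by
        simp only [dotProduct, Fin.sum_univ_three, Pi.smul_apply, smul_eq_mul, Complex.ofReal_mul,
          RingHom.id_apply, Complex.real_smul]
        ring }
  refine ⟨l, z, fun v => ?_, fun v => ?_, fun v hl hz => ?_⟩
  · change u ⬝ᵥ _ = u ⬝ᵥ _
    rw [Matrix.dotProduct_mulVec, hu, one_smul]
  · change w ⬝ᵥ (fun i => ((M.mulVec v) i : ℂ)) = e * (w ⬝ᵥ fun i => (v i : ℂ))
    rw [hmul, Matrix.dotProduct_mulVec, hw, smul_dotProduct, smul_eq_mul]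
  · replace hl : u ⬝ᵥ v = 0 := hl
    replace hz : w ⬝ᵥ (fun i => (v i : ℂ)) = 0 := hz
    have hsr : e' ≠ 1 := by
      rw [he]
      intro h
      exact he1 (by simpa using congrArg (starRingEnd ℂ) h)
    have huC : (fun i => (u i : ℂ)) ≠ 0 := fun h => hu0 (funext fun i => by
      simpa using congrFun h i)
    -- `M` is real, so the conjugate of `w` is a left eigenvector for `e'`, and it annihilates the
    -- real vector `v` too.
    have hx := eq_zero_of_dotProduct_eigenvectors (M := M.map (algebraMap ℝ ℂ))
      (μ := ![1, e, e']) (w := ![fun i => (u i : ℂ), w, star w]) (x := fun i => (v i : ℂ)) ?_ ?_ ?_ ?_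
    · ext i
      simpa using congrFun hx i
    · intro i j hij
      fin_cases i <;> fin_cases j <;> simp_all
    · intro i
      fin_cases i
      · exact huC
      · exact hw0
      · exact star_ne_zero.2 hw0
    · intro i
      fin_cases i
      · ext j
        have := congrArg (fun x : ℝ => (x : ℂ)) (congrFun hu j)
        simpa [Matrix.vecMul, dotProduct] using this
      · exact hw
      · ext j
        have := congrArg (starRingEnd ℂ) (congrFun hw j)
        simpa [Matrix.vecMul, dotProduct, he] using this
    · intro i
      fin_cases i
      · have := congrArg (fun x : ℝ => (x : ℂ)) hl
        simpa [dotProduct] using this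
      · exact hz
      · have := congrArg (starRingEnd ℂ) hz
        simpa [dotProduct] using this

/-! ### Simple curves in the Möbius band -/

/-- An equivariant simple curve in the open Möbius band, described in the universal cover whose
deck transformations are `(b, h) ↦ (b + n * π, (-1) ^ n * h)`. -/
theorem winding_of_equivariant_simple_curve {p k : ℕ} (hp : 3 ≤ p) (hk : 1 ≤ k) (hkp : 2 * k ≤ p)
    {b h : ℝ → ℝ} (hb : Continuous b) (hh : Continuous h) (j : ℤ)
    (hbs : ∀ t, b (t + 1 / p) = b t + (2 * k / p + j) * Real.pi)
    (hhs : ∀ t, h (t + 1 / p) = (-1) ^ j * h t)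
    (hinj : ∀ (s t : ℝ) (n : ℤ), b s = b t + n * Real.pi → h s = (-1) ^ n * h t →
      ∃ i : ℤ, s = t + i) :
    (k = 1 ∧ Even (j * p)) ∨ (p = 2 * k + 1 ∧ Odd (j * p)) := by
  have hp0 : (p : ℝ) ≠ 0 := by positivity
  have hpi := Real.pi_ne_zero
  have hbn (n : ℕ) (t : ℝ) : b (t + n / p) = b t + n * ((2 * k / p + j) * Real.pi) := by
    induction n with
    | zero => simp
    | succ n ih =>
      rw [show t + ((n + 1 : ℕ) : ℝ) / p = (t + n / p) + 1 / p by push_cast; ring, hbs, ih]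
      push_cast; ring
  have hhn (n : ℕ) (t : ℝ) : h (t + n / p) = ((-1) ^ j) ^ n * h t := by
    induction n with
    | zero => simp
    | succ n ih =>
      rw [show t + ((n + 1 : ℕ) : ℝ) / p = (t + n / p) + 1 / p by push_cast; ring, hhs, ih]
      ring
  have hsq : ((-1 : ℝ) ^ j) ^ 2 = 1 := by
    rcases Int.even_or_odd j with h | h <;> rw [h.neg_one_zpow] <;> norm_num
  obtain ⟨m, hm⟩ : ∃ m : ℤ, m = j * p + 2 * k := ⟨_, rfl⟩
  have hmr : (m : ℝ) = j * p + 2 * k := by rw [hm]; push_cast; ring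
  have hb1 (t : ℝ) : b (t + 1) = b t + m * Real.pi := by
    have := hbn p t
    rw [div_self hp0] at this
    rw [this, hmr]
    field_simp
    ring
  have hb2 (t : ℝ) : b (t + 2) = b t + 2 * m * Real.pi := by
    rw [show t + 2 = t + 1 + 1 by ring, hb1, hb1]; ring
  have hh2 : Function.Periodic h 2 := fun t => by
    have := hhn (2 * p) t
    rw [pow_mul, hsq, one_pow, one_mul] at this
    rw [← this]
    congr 2
    push_cast
    field_simp
  have hbi (i : ℤ) (t : ℝ) : b (t + i) = b t + i * (m * Real.pi) := by
    induction i with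
    | zero => simp
    | succ n ih => push_cast at ih ⊢; rw [← add_assoc, hb1, ih]; ring
    | pred n ih =>
      have := hb1 (t + ((-(n : ℤ) - 1 : ℤ) : ℝ))
      rw [show t + ((-(n : ℤ) - 1 : ℤ) : ℝ) + 1 = t + ((-(n : ℤ) : ℤ) : ℝ) by push_cast; ring, ih] at this
      push_cast at this ⊢
      linarith
  have hpz : (3 : ℤ) ≤ p := by exact_mod_cast hp
  have hkz : (1 : ℤ) ≤ k := by exact_mod_cast hk
  have hkpz : (2 : ℤ) * k ≤ p := by exact_mod_cast hkp
  -- `m = 0` forces `j = -1` and `p = 2k`; then the curve already closes up after `2/p`, which is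
  -- less than 1.
  have hm0 : m ≠ 0 := by
    rintro rfl
    have hj : j = -1 := by
      have h1 : j < 0 := by by_contra! hn; nlinarith
      have h2 : -2 < j := by by_contra! hn; nlinarith
      omega
    obtain ⟨i, hi⟩ := hinj (0 + (2 : ℕ) / p) 0 0 (by
      rw [hbn]
      have : (2 * k / p + j : ℝ) = 0 := by
        field_simp
        rw [Int.cast_zero] at hmr
        linarith
      rw [this]; simp) (by rw [hhn, hsq, zpow_zero])
    have h3 : (2 : ℤ) = i * p := by
      rw [zero_add, zero_add, div_eq_iff hp0] at hi
      exact_mod_cast hi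
    have h1 : 0 < i := by by_contra! hn; nlinarith
    nlinarith
  -- Over length 2 the sign of `h` cancels, so `h` is periodic; translation by `2π` is the deck
  -- transformation `n = 2`, which preserves `h`.
  obtain ⟨s, t, hst, hst'⟩ := exists_chord hb hh two_pos
    (show 2 * (m : ℝ) * Real.pi ≠ 0 by positivity) hh2 (fun t => hb2 t) (2 * Real.pi)
  obtain ⟨i, rfl⟩ := hinj s t 2 (by rw [hst]; norm_num) (by rw [hst']; norm_num)
  have him : i * m = 2 := by
    rw [hbi] at hst
    have : (i * m : ℝ) = 2 := mul_right_cancel₀ hpi (by linarith)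
    exact_mod_cast this
  have hmd : m ∣ 2 := ⟨i, by linarith⟩
  have hm2 : m ≤ 2 := Int.le_of_dvd two_pos hmd
  have hm2' : -2 ≤ m := by
    have := Int.le_of_dvd two_pos (neg_dvd.2 hmd)
    linarith
  have hj1 : -2 < j := by by_contra! hn; nlinarith
  have hj2 : j < 1 := by by_contra! hn; nlinarith
  have hj : j = 0 ∨ j = -1 := by omega
  rcases hj with rfl | rfl
  · left
    simp only [zero_mul, zero_add] at hm ⊢
    exact ⟨by omega, Even.zero⟩
  · have hcase : p = 2 * k + 1 ∨ p = 2 * k + 2 := by omega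
    rcases hcase with hpk | hpk
    · right
      refine ⟨hpk, ⟨-k - 1, ?_⟩⟩
      rw [hpk]; push_cast; ring
    · exfalso
      have hneg (t) : h (t + 1 / p) = -h t := by simpa using hhs t
      -- When `p = 2k + 2`, half a period lowers `b` by `π`. At a zero of `h` this gives the same
      -- point of the band, since the flip of `h` has no effect there.
      obtain ⟨t₀, ht₀⟩ : ∃ t₀, h t₀ = 0 := by
        have h1 := hneg 0
        rcases le_total (h 0) 0 with h2 | h2
        · exact mem_range_of_exists_le_of_exists_ge hh ⟨0, h2⟩ ⟨0 + 1 / p, by linarith⟩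
        · exact mem_range_of_exists_le_of_exists_ge hh ⟨0 + 1 / p, by linarith⟩ ⟨0, h2⟩
      have hpr : (p : ℝ) = 2 * k + 2 := by rw [hpk]; push_cast; ring
      obtain ⟨i, hi⟩ := hinj (t₀ + (k + 1 : ℕ) / p) t₀ (-1) (by
        rw [hbn, hpr]
        push_cast
        field_simp
        ring) (by rw [hhn, ht₀]; simp)
      have h1 : ((k + 1 : ℕ) : ℝ) = i * p := by
        rw [← div_eq_iff hp0]; linarith
      have h2 : (k + 1 : ℤ) = i * (2 * k + 2) := by
        rw [hpr] at h1
        exact_mod_cast h1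
      have h3 : 0 < i := by by_contra! hn; nlinarith
      nlinarith

/-! ### Polar coordinates of the lift and the conclusion -/

/-- Multiplying a vector by a real `c ≠ 0` changes its angle by `nπ`, where `(-1)^n` is the sign of
`c`. This is the source of the deck transformations. -/
theorem exists_int_of_polar_eq {c a a' β β' η η' : ℝ}
    (h1 : Complex.exp (a' + β' * Complex.I) = c * Complex.exp (a + β * Complex.I))
    (h2 : Real.exp a' * η' = c * (Real.exp a * η)) :
    ∃ n : ℤ, β' = β + n * Real.pi ∧ η' = (-1) ^ n * η ∧ 0 < c * (-1) ^ n := by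
  have h : Complex.exp (((a' - a : ℝ) : ℂ) + ((β' - β : ℝ) : ℂ) * Complex.I) = c := by
    rw [show ((a' - a : ℝ) : ℂ) + ((β' - β : ℝ) : ℂ) * Complex.I =
      (a' + β' * Complex.I) - (a + β * Complex.I) by push_cast; ring, Complex.exp_sub, h1,
      mul_div_assoc, div_self (Complex.exp_ne_zero _), mul_one]
  have him := congrArg Complex.im h
  have hre := congrArg Complex.re h
  rw [Complex.exp_im, Complex.ofReal_im] at him
  rw [Complex.exp_re, Complex.ofReal_re] at hre
  simp only [Complex.add_re, Complex.add_im, Complex.ofReal_re, Complex.ofReal_im,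
    Complex.re_ofReal_mul, Complex.im_ofReal_mul, Complex.I_re, Complex.I_im, mul_zero, mul_one,
    add_zero, zero_add, mul_eq_zero, Real.exp_ne_zero, false_or] at him hre
  obtain ⟨n, hn⟩ := Real.sin_eq_zero_iff.1 him
  rw [← hn, Real.cos_int_mul_pi] at hre
  refine ⟨n, by linarith, ?_, ?_⟩
  · refine mul_left_cancel₀ (Real.exp_ne_zero a') ?_
    rw [h2, ← hre, Real.exp_sub]
    field_simp [Real.exp_ne_zero]
  · rw [← hre, mul_assoc, ← mul_zpow]
    simp [Real.exp_pos]

theorem exists_int_eq_of_continuous {q : ℝ → ℝ} (hq : Continuous q) (h : ∀ t, ∃ n : ℤ, q t = n) :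
    ∃ n : ℤ, ∀ t, q t = n := by
  choose n hn using h
  have hc : Continuous n := by
    rw [Int.isClosedEmbedding_coe_real.isEmbedding.continuous_iff]
    exact hq.congr hn
  exact ⟨n 0, fun t => by rw [hn, PreconnectedSpace.constant inferInstance hc]⟩

theorem UnitAddCircle.exists_int_of_coe_eq {s t : ℝ} (h : (s : UnitAddCircle) = t) :
    ∃ i : ℤ, s = t + i := by
  rw [eq_comm, QuotientAddGroup.eq, AddSubgroup.mem_zmultiples_iff] at h
  obtain ⟨i, hi⟩ := h
  exact ⟨i, by rw [zsmul_one] at hi; linarith⟩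

theorem exp_two_pi_mul_I_div_ne {p : ℕ} (hp : 3 ≤ p) :
    Complex.exp (2 * Real.pi * Complex.I / p) ≠ 1 ∧
      Complex.exp (2 * Real.pi * Complex.I / p) ≠ Complex.exp (-(2 * Real.pi * Complex.I / p)) := by
  have hp0 : (p : ℂ) ≠ 0 := by
    have : p ≠ 0 := by omega
    exact_mod_cast this
  -- Both claims follow once the square of the eigenvalue is not 1, which is where `p ≥ 3` enters.
  have key : Complex.exp (2 * (2 * Real.pi * Complex.I / p)) ≠ 1 := by
    intro h
    obtain ⟨n, hn⟩ := Complex.exp_eq_one_iff.1 h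
    have hpi := Complex.two_pi_I_ne_zero
    have h2 : (2 : ℂ) = n * p := by
      rw [mul_div_assoc', div_eq_iff hp0] at hn
      refine mul_right_cancel₀ hpi ?_
      linear_combination hn
    have h3 : (2 : ℤ) = n * p := by exact_mod_cast h2
    have h1 : 0 < n := by
      by_contra! hn
      nlinarith
    have : (3 : ℤ) ≤ p := by exact_mod_cast hp
    nlinarith
  constructor
  · intro h
    apply key
    rw [two_mul, Complex.exp_add, h, one_mul]
  · intro h
    apply key
    rw [two_mul, Complex.exp_add]
    nth_rewrite 2 [h]
    rw [← Complex.exp_add, add_neg_cancel, Complex.exp_zero]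

theorem lemma3p1 (p k : ℕ) (hp : 3 ≤ p) (hk : 1 ≤ k) (hkp : (k : ℝ) ≤ (p : ℝ) / 2)
    (R : Matrix.SpecialLinearGroup (Fin 3) ℝ)
    (hR : ((R : Matrix (Fin 3) (Fin 3) ℝ).map (algebraMap ℝ ℂ)).charpoly.roots =
      {1, Complex.exp (2 * Real.pi * Complex.I / p), Complex.exp (-(2 * Real.pi * Complex.I / p))})
    (γ : C(UnitAddCircle, RealProjectivePlane)) (hγ : Function.Injective γ)
    (hsymm : ∀ t : UnitAddCircle, γ (t + ((1 / (p : ℝ) : ℝ) : UnitAddCircle)) = R ^ k • γ t) :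
    (k = 1 ∧ γ.Nullhomotopic) ∨
      (Odd p ∧ (k : ℝ) = ((p : ℝ) - 1) / 2 ∧ ¬ γ.Nullhomotopic) := by
  have hkp' : 2 * k ≤ p := by
    have : (2 * k : ℝ) ≤ p := by linarith
    exact_mod_cast this
  have hp0 : (p : ℝ) ≠ 0 := by positivity
  obtain ⟨he1, hee⟩ := exp_two_pi_mul_I_div_ne hp
  obtain ⟨l, z, hlR, hzR, hlz⟩ := exists_rotation_coordinates hR
    (by rw [← Complex.exp_conj]; simp [neg_div, map_ofNat]) he1 hee
  have hlk (n : ℕ) (v : Fin 3 → ℝ) : l (R ^ n • v) = l v := by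
    induction n with
    | zero => simp
    | succ n ih => rw [pow_succ', mul_smul, ← ih]; exact hlR _
  have hzn (n : ℕ) (v : Fin 3 → ℝ) : z (R ^ n • v) =
      Complex.exp (2 * Real.pi * Complex.I / p) ^ n * z v := by
    induction n with
    | zero => simp
    | succ n ih => rw [pow_succ', mul_smul, pow_succ', mul_assoc, ← ih]; exact hzR _
  have hzk (v : Fin 3 → ℝ) : z (R ^ k • v) =
      Complex.exp (((2 * k / p * Real.pi : ℝ) : ℂ) * Complex.I) * z v := by
    rw [hzn, ← Complex.exp_nat_mul]
    congr 2
    push_cast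
    ring
  have hinj (s t : ℝ) (h : γ s = γ t) : ∃ i : ℤ, s = t + i :=
    UnitAddCircle.exists_int_of_coe_eq (hγ h)
  obtain ⟨v, hv⟩ := exists_continuous_lift_sphere
    (γ.comp ⟨fun t : ℝ => (t : UnitAddCircle), AddCircle.continuous_mk' 1⟩)
  replace hv : ∀ t : ℝ, sphereToProjectivePlane (v t) = γ t := hv
  have hshift (t : ℝ) : ∃ c : ℝ, (v (t + 1 / p)).1 = c • (R ^ k • (v t).1) := by
    have h := hsymm t
    rw [← AddCircle.coe_add, ← hv, ← hv] at h
    obtain ⟨c, hc⟩ := (Projectivization.mk_eq_mk_iff' ℝ _ _ _ _).1 h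
    exact ⟨c, hc.symm⟩
  -- A point on the axis would be fixed by `R ^ k`, giving `γ (t + 1/p) = γ t`.
  have hz0 (t : ℝ) : z (v t).1 ≠ 0 := by
    intro h0
    have hfix : R ^ k • (v t).1 = (v t).1 := by
      rw [← sub_eq_zero]
      refine hlz _ ?_ ?_
      · rw [map_sub, hlk, sub_self]
      · rw [map_sub, hzk, h0, mul_zero, sub_zero]
    obtain ⟨c, hc⟩ := hshift t
    rw [hfix] at hc
    obtain ⟨i, hi⟩ := hinj (t + 1 / p) t (by
      rw [← hv, ← hv]
      exact (Projectivization.mk_eq_mk_iff' ℝ _ _ _ _).2 ⟨c, hc.symm⟩)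
    have h1 : (1 : ℤ) = i * p := by
      have : 1 / (p : ℝ) = i := by linarith
      rw [div_eq_iff hp0] at this
      exact_mod_cast this
    have := Int.eq_one_or_neg_one_of_mul_eq_one' h1.symm
    omega
  have hzc : Continuous z := z.continuous_of_finiteDimensional
  have hlc : Continuous l := l.continuous_of_finiteDimensional
  obtain ⟨g, hg⟩ := exists_continuous_log (A := ℝ)
    ⟨fun t => z (v t).1, hzc.comp (continuous_subtype_val.comp v.continuous)⟩ hz0
  let a : ℝ → ℝ := fun t => (g t).re
  let b : ℝ → ℝ := fun t => (g t).im
  let h : ℝ → ℝ := fun t => Real.exp (-a t) * l (v t).1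
  have hac : Continuous a := by fun_prop
  have hbc : Continuous b := by fun_prop
  have hhc : Continuous h := by fun_prop
  have hza (t : ℝ) : z (v t).1 = Complex.exp (a t + b t * Complex.I) := by
    rw [Complex.re_add_im, hg]; rfl
  have hla (t : ℝ) : l (v t).1 = Real.exp (a t) * h t := by
    rw [← mul_assoc, ← Real.exp_add, add_neg_cancel, Real.exp_zero, one_mul]
  have hstep (t : ℝ) : ∃ n : ℤ, b (t + 1 / p) = b t + 2 * k / p * Real.pi + n * Real.pi ∧
      h (t + 1 / p) = (-1) ^ n * h t := by
    obtain ⟨c, hc⟩ := hshift t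
    obtain ⟨n, h1, h2, -⟩ := exists_int_of_polar_eq (c := c) (a := a t) (a' := a (t + 1 / p))
      (β := b t + 2 * k / p * Real.pi) (β' := b (t + 1 / p)) (η := h t) (η' := h (t + 1 / p))
      (by
        rw [← hza, hc, map_smul, hzk, hza, Complex.real_smul, ← Complex.exp_add]
        congr 2
        push_cast
        ring)
      (by rw [← hla, hc, map_smul, hlk, hla, smul_eq_mul])
    exact ⟨n, h1, h2⟩
  -- The integer in `hstep` depends continuously on `t`, hence is constant.
  obtain ⟨j, hj⟩ := exists_int_eq_of_continuous
    (q := fun t => (b (t + 1 / p) - b t) / Real.pi - 2 * k / p) (by fun_prop) fun t => by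
      obtain ⟨n, hn, -⟩ := hstep t
      refine ⟨n, ?_⟩
      rw [hn]
      field_simp [Real.pi_ne_zero]
      ring
  have hbs (t : ℝ) : b (t + 1 / p) = b t + (2 * k / p + j) * Real.pi := by
    have := hj t
    field_simp [Real.pi_ne_zero] at this ⊢
    linarith
  have hhs (t : ℝ) : h (t + 1 / p) = (-1) ^ j * h t := by
    obtain ⟨n, h1, h2⟩ := hstep t
    have : n = j := by
      rw [hbs] at h1
      have : (j : ℝ) = n := mul_right_cancel₀ Real.pi_ne_zero (by linarith)
      exact_mod_cast this.symm
    rwa [this] at h2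
  have hcoord (s t : ℝ) (n : ℤ) (h1 : b s = b t + n * Real.pi) (h2 : h s = (-1) ^ n * h t) :
      ∃ i : ℤ, s = t + i := by
    refine hinj s t ?_
    rw [← hv, ← hv]
    refine (Projectivization.mk_eq_mk_iff' ℝ _ _ _ _).2
      ⟨Real.exp (a s - a t) * (-1) ^ n, ?_⟩
    rw [← sub_eq_zero]
    have hE : Real.exp (a s - a t) * Real.exp (a t) = Real.exp (a s) := by
      rw [← Real.exp_add, sub_add_cancel]
    have hpi : Complex.exp (n * Real.pi * Complex.I) = ((-1 : ℝ) ^ n : ℝ) := by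
      rw [mul_assoc, Complex.exp_int_mul, Complex.exp_pi_mul_I]; push_cast; rfl
    refine hlz _ ?_ ?_
    · rw [map_sub, map_smul, hla, hla, h2, smul_eq_mul, ← hE]
      ring
    · rw [map_sub, map_smul, hza, hza, h1, Complex.real_smul, Complex.ofReal_mul, ← hpi,
        Complex.ofReal_exp, ← Complex.exp_add, ← Complex.exp_add, sub_eq_zero]
      congr 1
      push_cast
      ring
  -- The sign is `(-1) ^ (2k + jp)`, so only the parity of `jp` matters.
  have hloop (t : ℝ) : v (t + 1) = if Even (j * p) then v t else -v t := by
    have hbn (n : ℕ) : b (t + n / p) = b t + n * ((2 * k / p + j) * Real.pi) := by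
      induction n with
      | zero => simp
      | succ n ih =>
        rw [show t + ((n + 1 : ℕ) : ℝ) / p = (t + n / p) + 1 / p by push_cast; ring, hbs, ih]
        push_cast; ring
    have hb1 : b (t + 1) = b t + ((2 * k + j * p : ℤ) : ℝ) * Real.pi := by
      have := hbn p
      rw [div_self hp0] at this
      rw [this]
      push_cast
      field_simp
    have hsgn : ∃ c : ℝ, (v (t + 1)).1 = c • (v t).1 := by
      obtain ⟨c, hc⟩ := (Projectivization.mk_eq_mk_iff' ℝ _ _ _ _).1
        ((hv (t + 1)).trans ((congrArg γ (AddCircle.coe_add_period 1 t)).trans (hv t).symm))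
      exact ⟨c, hc.symm⟩
    obtain ⟨c, hc⟩ := hsgn
    obtain ⟨n, h1, -, h3⟩ := exists_int_of_polar_eq (c := c) (a := a t) (a' := a (t + 1))
      (β := b t) (β' := b (t + 1)) (η := h t) (η' := h (t + 1))
      (by rw [← hza, hc, map_smul, hza, Complex.real_smul])
      (by rw [← hla, hc, map_smul, hla, smul_eq_mul])
    have hn : n = 2 * k + j * p := by
      rw [hb1] at h1
      have := mul_right_cancel₀ Real.pi_ne_zero (add_left_cancel h1)
      exact_mod_cast this.symm
    have hc1 : |c| = 1 := by
      have := congrArg norm hc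
      rw [norm_smul, norm_eq_of_mem_sphere, norm_eq_of_mem_sphere, mul_one] at this
      exact this.symm
    have hpar : Even n ↔ Even (j * p) := by
      rw [hn, Int.even_add]
      simp
    rcases eq_or_eq_neg_of_abs_eq hc1 with rfl | rfl
    · have : Even n := by
        by_contra hodd
        rw [(Int.not_even_iff_odd.1 hodd).neg_one_zpow] at h3
        norm_num at h3
      rw [if_pos (hpar.1 this)]
      exact Subtype.ext (by rw [hc, one_smul])
    · have : ¬ Even n := by
        intro hev
        rw [hev.neg_one_zpow] at h3
        norm_num at h3
      rw [if_neg (fun hh => this (hpar.2 hh))]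
      exact Subtype.ext (by rw [hc, neg_one_smul]; rfl)
  rcases winding_of_equivariant_simple_curve hp hk hkp' hbc hhc j hbs hhs hcoord with
    ⟨hk1, hev⟩ | ⟨hpk, hodd⟩
  · refine .inl ⟨hk1, ?_⟩
    simp only [if_pos hev] at hloop
    -- `N` spans the rotation axis, which the lift avoids by `hz0`.
    obtain ⟨N, hN, hN0⟩ := Submodule.exists_mem_ne_zero_of_ne_bot
      (LinearMap.ker_ne_bot_of_finrank_lt (f := z) (by simp [Complex.finrank_real_complex]))
    refine nullhomotopic_of_periodic_lift γ v hv hloop N hN0 fun t c hc => hz0 t ?_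
    rw [hc, map_smul, LinearMap.mem_ker.1 hN, smul_zero]
  · refine .inr ⟨⟨k, hpk⟩, by rw [hpk]; push_cast; ring, ?_⟩
    simp only [if_neg (Int.not_even_iff_odd.2 hodd)] at hloop
    exact not_nullhomotopic_of_antiperiodic_lift γ v hv hloop
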